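/- Let $\Phi$ be a homogeneous Poisson point process on $\mathbb{R}^2$ (with the Euclidean distance) of intensity $\lambda\in(0,\infty)$, regarded as a random locally finite subset of $\mathbb{R}^2$. Say that a point $x\in\Phi$ \emph{follows} $y\in\Phi$ if $y\neq x$ and $|x-y|\le|x-z|$ for every $z\in\Phi\setminus\{x\}$, i.e. if $y$ is a nearest neighbour of $x$ in $\Phi$. The \emph{nearest neighbour graph} of $\Phi$ has the points of $\Phi$ as vertices and an edge between $x$ and $y$ whenever $x$ follows $y$ or $y$ follows $x$. For $x\in\Phi$, the \emph{forward set} $\mathrm{For}(x,\Phi)$ is the set of all points that can be reached from $x$ by a finite (possibly empty) chain $x=x_0,x_1,\dots,x_k$ in which each $x_i$ follows $x_{i+1}$, and the \emph{backward set} is $\mathrm{Back}(x,\Phi)=\{y : x\in\mathrm{For}(y,\Phi)\}$. Let $\mathbb{P}^0$ be the Palm probability of $\Phi$, i.e. the probability measure on locally finite configurations given by $$\mathbb{P}^0(A)=\frac1\lambda\,\mathbb{E}\Big[\#\{x\in\Phi\cap[0,1)^2 : \Phi-x\in A\}\Big].$$ Then the nearest neighbour graph does not percolate: 1. almost surely,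 every connected component of the nearest neighbour graph of $\Phi$ is finite; 2. for $\mathbb{P}^0$-almost every configuration $\eta$, the forward set $\mathrm{For}(0,\eta)$ and the backward set $\mathrm{Back}(0,\eta)$ of the origin are both finite. -/

import Mathlib

open MeasureTheory ProbabilityTheory
open scoped NNReal ENNReal

noncomputable section

/-- The Euclidean plane. -/
abbrev Plane : Type := EuclideanSpace ℝ (Fin 2)

/-- A locally finite subset of the plane. -/
@[ext]
structure Config where
  carrier : Set Plane
  finite_inter : ∀ K : Set Plane, IsCompact K → (carrier ∩ K).Finite

namespace Config

/-- The counting measure `∑_{x ∈ η} δ_x` of a configuration `η`. -/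
def toMeasure (η : Config) : Measure Plane := Measure.count.restrict η.carrier

/-- The `σ`-algebra on configurations: the smallest one for which `η ↦ η(B)` is measurable for
every Borel set `B`. -/
instance : MeasurableSpace Config := MeasurableSpace.comap toMeasure inferInstance

theorem measurable_toMeasure : Measurable toMeasure := comap_measurable _

/-- The configuration seen from `x`: every point is translated by `-x`. -/
def shift (η : Config) (x : Plane) : Config where
  carrier := (fun y => y - x) '' η.carrier
  finite_inter K hK := by
    refine ((η.finite_inter _ (hK.image (continuous_id.add_const x))).image
      (fun y => y - x)).subset ?_
    rintro _ ⟨⟨y, hy, rfl⟩, hK'⟩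
    exact ⟨y, ⟨hy, y - x, hK', by simp⟩, rfl⟩

/-- `x` follows `y` in `η`: both are points of `η`, and `y` is a nearest neighbour of `x` among the
other points of `η`. -/
def Follows (η : Config) (x y : Plane) : Prop :=
  x ∈ η.carrier ∧ y ∈ η.carrier ∧ y ≠ x ∧ ∀ z ∈ η.carrier, z ≠ x → dist x y ≤ dist x z

/-- The (undirected) nearest neighbour graph, with the points of `η` as vertices. -/
def nnGraph (η : Config) : SimpleGraph η.carrier :=
  SimpleGraph.fromRel fun x y => η.Follows x y

/-- The leaders of `x` of all orders (order `0`, that is `x` itself, included). -/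
def forwardSet (η : Config) (x : Plane) : Set Plane := {y | Relation.ReflTransGen η.Follows x y}

/-- The followers of `x` of all orders (order `0`, that is `x` itself, included). -/
def backwardSet (η : Config) (x : Plane) : Set Plane := {y | Relation.ReflTransGen η.Follows y x}

/-- The counting measure of a configuration, as a kernel. -/
def countingKernel : Kernel Config Plane := ⟨toMeasure, measurable_toMeasure⟩

theorem countingKernel_apply (η : Config) : countingKernel η = η.toMeasure := rfl

theorem measurableSet_carrier (η : Config) : MeasurableSet η.carrier := by
  have h : η.carrier = ⋃ n : ℕ, η.carrier ∩ Metric.closedBall 0 n := by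
    rw [← Set.inter_iUnion, Metric.iUnion_closedBall_nat, Set.inter_univ]
  rw [h]
  exact MeasurableSet.iUnion fun n =>
    (η.finite_inter _ (isCompact_closedBall 0 (n : ℝ))).measurableSet

theorem toMeasure_apply (η : Config) {B : Set Plane} (hB : MeasurableSet B) :
    η.toMeasure B = (η.carrier ∩ B).encard := by
  rw [toMeasure, Measure.restrict_apply hB, Set.inter_comm,
    Measure.count_apply (η.measurableSet_carrier.inter hB)]

theorem toMeasure_shift (η : Config) (x : Plane) {B : Set Plane} (hB : MeasurableSet B) :
    (η.shift x).toMeasure B = ∫⁻ y, B.indicator 1 (y - x) ∂η.toMeasure := by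
  have hB' : MeasurableSet ((fun y : Plane => y - x) ⁻¹' B) :=
    (measurable_id.sub_const x) hB
  have h : (η.shift x).carrier ∩ B
      = (fun y => y - x) '' (η.carrier ∩ (fun y : Plane => y - x) ⁻¹' B) :=
    (Set.image_inter_preimage _ _ _).symm
  rw [toMeasure_apply _ hB, h, (sub_left_injective).encard_image, ← toMeasure_apply _ hB',
    ← lintegral_indicator_one hB']
  rfl

def shell (n : ℕ) : Set Plane := disjointed (fun k : ℕ => Metric.closedBall (0 : Plane) k) n

theorem measurableSet_shell (n : ℕ) : MeasurableSet (shell n) :=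
  MeasurableSet.disjointed (fun _ => Metric.isClosed_closedBall.measurableSet) n

theorem exists_toMeasure_shell (η : Config) (n : ℕ) :
    ∃ m : ℕ, η.toMeasure (shell n) = m := by
  rw [toMeasure_apply _ (measurableSet_shell n)]
  have hf : (η.carrier ∩ shell n).Finite :=
    (η.finite_inter _ (isCompact_closedBall 0 (n : ℝ))).subset
      (Set.inter_subset_inter_right _ (disjointed_subset _ n))
  refine ⟨(η.carrier ∩ shell n).ncard, ?_⟩
  rw [← hf.cast_ncard_eq]
  rfl

theorem measurableSet_level (p : ℕ × ℕ) :
    MeasurableSet {η : Config | η.toMeasure (shell p.1) = p.2} :=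
  ((Measure.measurable_coe (measurableSet_shell p.1)).comp measurable_toMeasure)
    (measurableSet_singleton _)

open Classical in
def piece (p : ℕ × ℕ) : Kernel Config Plane :=
  Kernel.piecewise (measurableSet_level p) (countingKernel.restrict (measurableSet_shell p.1)) 0

instance : IsSFiniteKernel countingKernel := by
  classical
  have hfin : ∀ p, IsFiniteKernel (piece p) := fun p => by
    refine ⟨(p.2 : ℝ≥0∞), ENNReal.natCast_lt_top _, fun η => ?_⟩
    by_cases h : η.toMeasure (shell p.1) = p.2
    · simp [piece, Kernel.piecewise_apply, h, Kernel.restrict_apply, countingKernel_apply]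
    · simp [piece, Kernel.piecewise_apply, h]
  have hsum : Kernel.sum piece = countingKernel := by
    ext η B hB
    rw [Kernel.sum_apply' _ _ hB, ENNReal.tsum_prod', countingKernel_apply]
    have hU : (⋃ n, shell n) = Set.univ := by
      unfold shell
      rw [iUnion_disjointed, Metric.iUnion_closedBall_nat]
    have hB' : η.toMeasure B = ∑' n, η.toMeasure (B ∩ shell n) := by
      rw [← measure_iUnion ?_ fun n => hB.inter (measurableSet_shell n), ← Set.inter_iUnion, hU,
        Set.inter_univ]
      intro i j hij
      exact ((disjoint_disjointed _ hij).mono Set.inter_subset_right Set.inter_subset_right)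
    rw [hB']
    refine tsum_congr fun n => ?_
    obtain ⟨m, hm⟩ := exists_toMeasure_shell η n
    rw [tsum_eq_single m]
    · simp [piece, Kernel.piecewise_apply, hm, Kernel.restrict_apply, countingKernel_apply,
        Measure.restrict_apply hB]
    · intro k hk
      have : (m : ℝ≥0∞) ≠ k := by exact_mod_cast hk.symm
      simp [piece, Kernel.piecewise_apply, hm, this]
  rw [← hsum]
  exact Kernel.isSFiniteKernel_sum

theorem measurable_shift : Measurable fun p : Config × Plane => p.1.shift p.2 := by
  refine measurable_iff_comap_le.mpr ?_
  change MeasurableSpace.comap _ (MeasurableSpace.comap _ _) ≤ _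
  rw [MeasurableSpace.comap_comp, ← measurable_iff_comap_le]
  refine Measure.measurable_of_measurable_coe _ fun B hB => ?_
  have h : (fun p : Config × Plane => (toMeasure ∘ fun p => p.1.shift p.2) p B)
      = fun p => ∫⁻ y, B.indicator (1 : Plane → ℝ≥0∞) (y - p.2)
          ∂(Kernel.prodMkRight Plane countingKernel) p := by
    funext p
    rw [Kernel.prodMkRight_apply, countingKernel_apply, Function.comp_apply, toMeasure_shift _ _ hB]
  rw [h]
  refine Measurable.lintegral_kernel_prod_right
    (f := fun (p : Config × Plane) y => B.indicator (1 : Plane → ℝ≥0∞) (y - p.2)) ?_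
  exact (measurable_one.indicator hB).comp (measurable_snd.sub measurable_fst.snd)

end Config

/-- The half-open unit square, a window of area one. -/
def unitSquare : Set Plane := {x | ∀ i, x i ∈ Set.Ico (0 : ℝ) 1}

theorem measurableSet_unitSquare : MeasurableSet unitSquare := by
  have : unitSquare = ⋂ i : Fin 2, (fun x : Plane => x i) ⁻¹' Set.Ico (0 : ℝ) 1 := by
    ext x; simp [unitSquare]
  rw [this]
  exact MeasurableSet.iInter fun i =>
    (by fun_prop : Measurable fun x : Plane => x i) measurableSet_Ico

/-- The intensity of a stationary point process with law `μ`: the mean number of points in the unit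
square. -/
def intensity (μ : Measure Config) : ℝ≥0∞ := ∫⁻ η, η.toMeasure unitSquare ∂μ

/-- The Palm distribution of a stationary point process with law `μ`. The Campbell measure
`μ ⊗ₘ countingKernel` is the law of a configuration together with a mark on each of its points; it
is restricted to the marks in the unit square, the configuration is translated so that the marked
point becomes the origin, and the result is divided by the intensity. See `palm_apply`. -/
def palm (μ : Measure Config) : Measure Config :=
  (intensity μ)⁻¹ •
    (((μ ⊗ₘ Config.countingKernel).restrict (Set.univ ×ˢ unitSquare)).map
      fun p => p.1.shift p.2)

/-- Campbell's formula for the Palm distribution: `palm μ A` is `(intensity μ)⁻¹` times the expected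
number of points `x` of `η` in the unit square such that `η - x` belongs to `A`. -/
theorem palm_apply (μ : Measure Config) [SFinite μ] {A : Set Config} (hA : MeasurableSet A) :
    palm μ A = (intensity μ)⁻¹ *
      ∫⁻ η, ((η.carrier ∩ {x | x ∈ unitSquare ∧ η.shift x ∈ A}).encard : ℝ≥0∞) ∂μ := by
  have hA' := Config.measurable_shift hA
  have hS : MeasurableSet ((Set.univ : Set Config) ×ˢ unitSquare) :=
    MeasurableSet.univ.prod measurableSet_unitSquare
  rw [palm, Measure.smul_apply, smul_eq_mul, Measure.map_apply Config.measurable_shift hA,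
    Measure.restrict_apply hA', Measure.compProd_apply (hA'.inter hS)]
  congr 1
  refine lintegral_congr fun η => ?_
  rw [Config.countingKernel_apply,
    Config.toMeasure_apply _ (measurable_prodMk_left (hA'.inter hS))]
  congr 3
  ext x
  simp [and_comm]

theorem isProbabilityMeasure_palm (μ : Measure Config) [SFinite μ] (h0 : intensity μ ≠ 0)
    (h1 : intensity μ ≠ ∞) : IsProbabilityMeasure (palm μ) := by
  refine ⟨?_⟩
  rw [palm_apply μ MeasurableSet.univ]
  have : ∀ η : Config, ((η.carrier ∩ {x | x ∈ unitSquare ∧ η.shift x ∈ Set.univ}).encard : ℝ≥0∞)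
      = η.toMeasure unitSquare := fun η => by
    rw [Config.toMeasure_apply _ measurableSet_unitSquare]
    simp
  simp_rw [this]
  exact ENNReal.inv_mul_cancel h0 h1

/-- `Φ` is a homogeneous Poisson point process on the plane with intensity `lam`: the numbers of
points in pairwise disjoint Borel sets are independent, and the number of points in a Borel set `B`
of finite area `|B|` has the Poisson distribution with mean `lam * |B|`. -/
structure IsHomogeneousPoisson {Ω : Type*} [MeasurableSpace Ω] (P : Measure Ω)
    (Φ : Ω → Config) (lam : ℝ≥0) : Prop where
  measurable : Measurable Φ
  indep : ∀ (n : ℕ) (B : Fin n → Set Plane), (∀ i, MeasurableSet (B i)) →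
    Pairwise (fun i j => Disjoint (B i) (B j)) →
    iIndepFun (fun i ω => (Φ ω).toMeasure (B i)) P
  law : ∀ B : Set Plane, MeasurableSet B → volume B ≠ ∞ →
    HasLaw (fun ω => (Φ ω).toMeasure B)
      ((poissonMeasure (lam * (volume B).toNNReal)).map fun n : ℕ => (n : ℝ≥0∞)) P

end

/-!
The proof is a direct first moment argument; it uses no property of the process beyond the
independence of the counts of disjoint sets and their Poisson laws.

Almost surely no point is equidistant from two others (`IsHomogeneousPoisson.ae_unique_leader`).
A self-avoiding path in the nearest neighbour graph then first goes from followers to leaders and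
afterwards from leaders to followers (`Config.exists_turning_point`), so the lengths of its edges
are first nonincreasing and then nondecreasing. Let `N` be a large scale. If there are no voids of
size `N` in a disc whose radius is a large multiple of `N ^ 4`, then the edges of a path inside the
disc are shorter than `2 * N` (`Config.dist_lt_of_follows`), and a path from near the origin to the
boundary of the disc has at least of order `N ^ 3` edges. Cover the disc of radius `2 * N` by
order `N ^ 2` annuli of equal area, with `lam` times that area at most `1 / 2`. By the pigeonhole
principle for monotone sequences, `N` consecutive edges of the path belong to the same annulus
(`Config.norm_le_of_reachable`).

The expected number of chains of `N` steps whose increments all belong to a given one of the annuli,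
and which start in the disc, is at most `lam` times the area of the disc times `(1 / 2) ^ N`. This
follows from the bound `lam ^ n * volume K` for the probability that some `n`-tuple of distinct
points of the process lies in a compact set `K`
(`IsHomogeneousPoisson.measure_exists_injective_mem_le`), applied to `chainSet`. A void of size `N`
in the disc has exponentially small probability too. Almost surely, therefore, infinitely many
scales `N` have neither voids nor chains, and every component is bounded, hence finite.

For the Palm probability, the configurations for which the forward and backward sets of the origin
are finite form a measurable set (`Config.measurableSet_finite_forwardSet_backwardSet`), and both
sets, seen from a point of the process, are translates of subsets of its component.
-/

/-! ### Grid cells -/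

/-- The half-open square of side `h` with lower left corner `h • z`. -/
def gridCell (h : ℝ) (z : Fin 2 → ℤ) : Set Plane := {x | ∀ i, ⌊x i / h⌋ = z i}

/-- The index of the grid cell containing `x`. -/
noncomputable def gridIndex (h : ℝ) (x : Plane) : Fin 2 → ℤ := fun i => ⌊x i / h⌋

theorem mem_gridCell_iff {h : ℝ} {z : Fin 2 → ℤ} {x : Plane} :
    x ∈ gridCell h z ↔ gridIndex h x = z := funext_iff.symm

theorem mem_gridCell_gridIndex (h : ℝ) (x : Plane) : x ∈ gridCell h (gridIndex h x) :=
  mem_gridCell_iff.2 rfl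

theorem measurableSet_gridCell (h : ℝ) (z : Fin 2 → ℤ) : MeasurableSet (gridCell h z) := by
  have : gridCell h z = ⋂ i : Fin 2, (fun x : Plane => ⌊x i / h⌋) ⁻¹' {z i} := by
    ext x; simp [gridCell]
  rw [this]
  exact MeasurableSet.iInter fun i =>
    (Int.measurable_floor.comp (by fun_prop : Measurable fun x : Plane => x i / h))
      (measurableSet_singleton _)

theorem disjoint_gridCell (h : ℝ) {z w : Fin 2 → ℤ} (hzw : z ≠ w) :
    Disjoint (gridCell h z) (gridCell h w) :=
  Set.disjoint_left.2 fun _ hx hy => hzw ((mem_gridCell_iff.1 hx).symm.trans (mem_gridCell_iff.1 hy))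

theorem volume_gridCell {h : ℝ} (hh : 0 < h) (z : Fin 2 → ℤ) :
    volume (gridCell h z) = ENNReal.ofReal (h ^ 2) := by
  have : gridCell h z = (@WithLp.ofLp 2 (Fin 2 → ℝ)) ⁻¹'
      (Set.univ.pi fun i => Set.Ico ((z i : ℝ) * h) ((z i : ℝ) * h + h)) := by
    ext x
    simp only [gridCell, Set.mem_ofPred_eq, Int.floor_eq_iff, Set.mem_preimage, Set.mem_pi,
      Set.mem_univ, true_implies, Set.mem_Ico, le_div_iff₀ hh, div_lt_iff₀ hh, add_mul, one_mul]
  rw [this, (PiLp.volume_preserving_ofLp (Fin 2)).measure_preimage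
    (MeasurableSet.univ_pi fun i => measurableSet_Ico).nullMeasurableSet, Real.volume_pi_Ico]
  simp [sq, ENNReal.ofReal_mul hh.le]

theorem dist_le_of_mem_gridCell {h : ℝ} (hh : 0 < h) {z : Fin 2 → ℤ} {x y : Plane}
    (hx : x ∈ gridCell h z) (hy : y ∈ gridCell h z) : dist x y ≤ 3 / 2 * h := by
  have key : ∀ i, (x i - y i) ^ 2 ≤ h ^ 2 := fun i => by
    have h1 := Int.abs_sub_lt_one_of_floor_eq_floor ((hx i).trans (hy i).symm)
    rw [← sub_div, abs_div, abs_of_pos hh, div_lt_one hh] at h1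
    exact sq_le_sq' (by linarith [neg_abs_le (x i - y i)]) (by linarith [le_abs_self (x i - y i)])
  rw [EuclideanSpace.dist_eq, Fin.sum_univ_two, Real.dist_eq, Real.dist_eq, sq_abs, sq_abs]
  refine Real.sqrt_le_iff.2 ⟨by positivity, ?_⟩
  nlinarith [key 0, key 1]

/-! ### The first moment bound -/

open Filter Topology in
theorem measure_le_of_forall_eventually_mem {Ω : Type*} [MeasurableSpace Ω] {P : Measure Ω}
    {E : Set Ω} {D : ℕ → Set Ω} {b : ℕ → ℝ≥0∞} {c : ℝ≥0∞}
    (hE : ∀ ω ∈ E, ∀ᶠ m in atTop, ω ∈ D m) (hD : ∀ m, P (D m) ≤ b m)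
    (hb : Tendsto b atTop (𝓝 c)) : P E ≤ c := by
  have hsub : E ⊆ ⋃ M, ⋂ m ≥ M, D m := fun ω hω => by
    obtain ⟨M, hM⟩ := eventually_atTop.1 (hE ω hω)
    exact Set.mem_iUnion.2 ⟨M, Set.mem_iInter₂.2 hM⟩
  have hmono : Monotone fun M => ⋂ m ≥ M, D m := fun M M' h =>
    Set.biInter_subset_biInter_left fun m hm => le_trans h hm
  refine (measure_mono hsub).trans ?_
  refine le_of_tendsto_of_tendsto (tendsto_measure_iUnion_atTop hmono) hb
    (Eventually.of_forall fun M => ?_)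
  exact (measure_mono (Set.biInter_subset_of_mem (le_refl M))).trans (hD M)

namespace IsHomogeneousPoisson

variable {Ω : Type*} [MeasurableSpace Ω] {P : Measure Ω} {Φ : Ω → Config} {lam : ℝ≥0}

theorem measure_void (hΦ : IsHomogeneousPoisson P Φ lam) {B : Set Plane} (hB : MeasurableSet B)
    (hv : volume B ≠ ∞) :
    P {ω | (Φ ω).toMeasure B = 0} = ENNReal.ofReal (Real.exp (-(lam * (volume B).toReal))) := by
  have hl := hΦ.law B hB hv
  have h1 : P {ω | (Φ ω).toMeasure B = 0} = P.map (fun ω => (Φ ω).toMeasure B) {0} :=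
    (Measure.map_apply_of_aemeasurable hl.aemeasurable (measurableSet_singleton _)).symm
  rw [h1, hl.map_eq, Measure.map_apply (by fun_prop) (measurableSet_singleton _)]
  have h2 : (fun n : ℕ => (n : ℝ≥0∞)) ⁻¹' {0} = {0} := by ext n; simp
  rw [h2, poissonMeasure_singleton]
  simp [ENNReal.coe_toNNReal_eq_toReal]

theorem measure_occupied_le [IsProbabilityMeasure P] (hΦ : IsHomogeneousPoisson P Φ lam)
    {B : Set Plane} (hB : MeasurableSet B) (hv : volume B ≠ ∞) :
    P {ω | (Φ ω).toMeasure B ≠ 0} ≤ lam * volume B := by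
  have hm : MeasurableSet {ω | (Φ ω).toMeasure B = 0} :=
    ((Measure.measurable_coe hB).comp (Config.measurable_toMeasure.comp hΦ.measurable))
      (measurableSet_singleton _)
  have h1 : {ω | (Φ ω).toMeasure B ≠ 0} = {ω | (Φ ω).toMeasure B = 0}ᶜ := rfl
  rw [h1, prob_compl_eq_one_sub hm, hΦ.measure_void hB hv, ← ENNReal.ofReal_one,
    ← ENNReal.ofReal_sub _ (Real.exp_pos _).le, ← ENNReal.ofReal_toReal hv,
    ← ENNReal.ofReal_coe_nnreal, ← ENNReal.ofReal_mul lam.coe_nonneg, ENNReal.toReal_ofReal (by positivity)]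
  exact ENNReal.ofReal_le_ofReal (by
    have := Real.add_one_le_exp (-(lam * (volume B).toReal))
    linarith)

open Filter Topology Metric in
/-- First moment bound: the probability that some `n`-tuple of distinct points of the process lies
in a compact set `K` is at most `lam ^ n * volume K`. With probability tending to one as the mesh
tends to zero, distinct points are in distinct cells of a grid; occupation numbers of distinct cells
are independent, so that a union bound over the product cells meeting `K` gives the volume of a
small thickening of `K`. -/
theorem measure_exists_injective_mem_le [IsProbabilityMeasure P]
    (hΦ : IsHomogeneousPoisson P Φ lam) {n : ℕ} {K : Set (Fin n → Plane)} (hK : IsCompact K) :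
    P {ω | ∃ x : Fin n → Plane, Function.Injective x ∧ (∀ i, x i ∈ (Φ ω).carrier) ∧ x ∈ K} ≤
      (lam : ℝ≥0∞) ^ n * volume K := by
  set h : ℕ → ℝ := fun m => 1 / ((m : ℝ) + 1) with hh
  have hpos : ∀ m, 0 < h m := fun m => by positivity
  have hlim : Tendsto h atTop (𝓝 0) := tendsto_one_div_add_atTop_nhds_zero_nat
  have hlim2 : Tendsto (fun m => 3 / 2 * h m) atTop (𝓝 0) := by simpa using hlim.const_mul (3 / 2)
  -- the product cells of mesh `h m`
  set C : ℕ → (Fin n → Fin 2 → ℤ) → Set (Fin n → Plane) :=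
    fun m z => Set.univ.pi fun i => gridCell (h m) (z i) with hC
  set T : ℕ → Set (Fin n → Fin 2 → ℤ) :=
    fun m => {z | Function.Injective z ∧ (C m z ∩ K).Nonempty} with hT
  -- the event that all factors of a product cell are occupied
  set A : ℕ → (Fin n → Fin 2 → ℤ) → Set Ω :=
    fun m z => ⋂ i ∈ Finset.univ, (fun ω => (Φ ω).toMeasure (gridCell (h m) (z i))) ⁻¹' {0}ᶜ with hA
  refine measure_le_of_forall_eventually_mem (D := fun m => ⋃ z : T m, A m z)
    (b := fun m => (lam : ℝ≥0∞) ^ n * volume (cthickening (3 / 2 * h m) K)) ?_ ?_ ?_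
  · rintro ω ⟨x, hx, hxΦ, hxK⟩
    have hsep : ∀ i j, i ≠ j → ∀ᶠ m in atTop, 3 / 2 * h m < dist (x i) (x j) := fun i j hij =>
      hlim2.eventually_lt_const (dist_pos.2 (hx.ne hij))
    have hsep' : ∀ᶠ m in atTop, ∀ i j, i ≠ j → 3 / 2 * h m < dist (x i) (x j) := by
      simpa only [eventually_all] using hsep
    filter_upwards [hsep'] with m hm
    refine Set.mem_iUnion.2 ⟨⟨fun i => gridIndex (h m) (x i), ?_, x, ?_, hxK⟩, ?_⟩
    · intro i j hij
      by_contra hne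
      refine (hm i j hne).not_ge (dist_le_of_mem_gridCell (hpos m)
        (mem_gridCell_gridIndex _ _) (mem_gridCell_iff.2 hij.symm))
    · exact fun i _ => mem_gridCell_gridIndex _ _
    · refine Set.mem_iInter₂.2 fun i _ => ?_
      change (Φ ω).toMeasure _ ≠ 0
      rw [Config.toMeasure_apply _ (measurableSet_gridCell _ _)]
      have : ((Φ ω).carrier ∩ gridCell (h m) (gridIndex (h m) (x i))).Nonempty :=
        ⟨x i, hxΦ i, mem_gridCell_gridIndex _ _⟩
      simpa using this.ne_empty
  · intro m
    have hCm : ∀ z, MeasurableSet (C m z) := fun z =>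
      MeasurableSet.univ_pi fun i => measurableSet_gridCell _ _
    have hfin : ∀ z, volume (gridCell (h m) z) ≠ ∞ := fun z => by
      rw [volume_gridCell (hpos m)]; exact ENNReal.ofReal_ne_top
    calc P (⋃ z : T m, A m z) ≤ ∑' z : T m, P (A m z) := measure_iUnion_le _
      _ ≤ ∑' z : T m, (lam : ℝ≥0∞) ^ n * volume (C m z) := by
          refine ENNReal.tsum_le_tsum fun z => ?_
          have hind := hΦ.indep n (fun i => gridCell (h m) (z.1 i))
            (fun i => measurableSet_gridCell _ _)
            (fun i j hij => disjoint_gridCell _ (z.2.1.ne hij))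
          rw [hA, hind.measure_inter_preimage_eq_mul _
            (fun i _ => (measurableSet_singleton (0 : ℝ≥0∞)).compl), hC, volume_pi_pi]
          calc _ ≤ ∏ i : Fin n, (lam : ℝ≥0∞) * volume (gridCell (h m) (z.1 i)) :=
                Finset.prod_le_prod' fun i _ =>
                  hΦ.measure_occupied_le (measurableSet_gridCell _ _) (hfin _)
            _ = _ := by simp [Finset.prod_mul_distrib]
      _ = (lam : ℝ≥0∞) ^ n * volume (⋃ z : T m, C m z) := by
          rw [ENNReal.tsum_mul_left, measure_iUnion ?_ fun z => hCm _]
          intro z w hzw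
          obtain ⟨i, hi⟩ := Function.ne_iff.1 (Subtype.coe_injective.ne hzw)
          exact Set.disjoint_univ_pi.2 ⟨i, disjoint_gridCell _ hi⟩
      _ ≤ _ := by
          gcongr
          refine Set.iUnion_subset fun z x hx => ?_
          obtain ⟨y, hy, hyK⟩ := z.2.2
          refine mem_cthickening_of_dist_le x y _ K hyK ?_
          exact (dist_pi_le_iff (by have := hpos m; positivity)).2 fun i =>
            dist_le_of_mem_gridCell (hpos m) (hx i trivial) (hy i trivial)
  · exact ENNReal.Tendsto.const_mul ((tendsto_measure_cthickening_of_isCompact hK).comp hlim2)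
      (Or.inr (by simp))

end IsHomogeneousPoisson

/-! ### Volumes of the relevant sets of tuples -/

/-- The `(k + 1)`-tuples of points of the plane that start in `A` and whose increments are in
`B`. -/
def chainSet (k : ℕ) (A B : Set Plane) : Set (Fin (k + 1) → Plane) :=
  {x | x 0 ∈ A ∧ ∀ i : Fin k, x i.succ - x i.castSucc ∈ B}

theorem measurableSet_chainSet (k : ℕ) {A B : Set Plane} (hA : MeasurableSet A)
    (hB : MeasurableSet B) : MeasurableSet (chainSet k A B) := by
  have : chainSet k A B = (fun x : Fin (k + 1) → Plane => x 0) ⁻¹' A ∩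
      ⋂ i : Fin k, (fun x : Fin (k + 1) → Plane => x i.succ - x i.castSucc) ⁻¹' B := by
    ext x; simp [chainSet]
  rw [this]
  exact (measurable_pi_apply (0 : Fin (k + 1)) hA).inter (MeasurableSet.iInter fun i =>
    ((measurable_pi_apply i.succ).sub (measurable_pi_apply i.castSucc)) hB)

theorem isClosed_chainSet (k : ℕ) {A B : Set Plane} (hA : IsClosed A) (hB : IsClosed B) :
    IsClosed (chainSet k A B) := by
  have : chainSet k A B = (fun x : Fin (k + 1) → Plane => x 0) ⁻¹' A ∩
      ⋂ i : Fin k, (fun x : Fin (k + 1) → Plane => x i.succ - x i.castSucc) ⁻¹' B := by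
    ext x; simp [chainSet]
  rw [this]
  exact (hA.preimage (by fun_prop)).inter (isClosed_iInter fun i => hB.preimage (by fun_prop))

theorem mem_chainSet_succ_iff {k : ℕ} {A B : Set Plane} {x : Fin (k + 2) → Plane} :
    x ∈ chainSet (k + 1) A B ↔ (fun i : Fin (k + 1) => x i.castSucc) ∈ chainSet k A B ∧
      x (Fin.last _) - x (Fin.last k).castSucc ∈ B := by
  simp only [chainSet, Set.mem_ofPred_eq, Fin.forall_fin_succ', Fin.succ_last, Fin.castSucc_zero,
    Fin.succ_castSucc, and_assoc]

theorem isCompact_chainSet (k : ℕ) {A B : Set Plane} (hA : IsCompact A) (hB : IsCompact B) :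
    IsCompact (chainSet k A B) := by
  induction k with
  | zero =>
    refine (isCompact_univ_pi fun _ => hA).of_isClosed_subset
      (isClosed_chainSet _ hA.isClosed hB.isClosed) fun x hx i _ => ?_
    rw [Fin.fin_one_eq_zero i]; exact hx.1
  | succ k ih =>
    have hcont : Continuous fun p : (Fin (k + 1) → Plane) × Plane =>
        (Fin.snoc p.1 (p.1 (Fin.last k) + p.2) : Fin (k + 2) → Plane) :=
      Continuous.finSnoc (A := fun _ => Plane) continuous_fst
        (((continuous_apply (Fin.last k)).comp continuous_fst).add continuous_snd)
    refine ((ih.prod hB).image hcont).of_isClosed_subset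
      (isClosed_chainSet _ hA.isClosed hB.isClosed) fun x hx => ?_
    obtain ⟨h1, h2⟩ := mem_chainSet_succ_iff.1 hx
    refine ⟨(_, _), ⟨h1, h2⟩, ?_⟩
    simp only [add_sub_cancel]
    exact Fin.snoc_init_self x

theorem volume_chainSet (k : ℕ) {A B : Set Plane} (hA : MeasurableSet A) (hB : MeasurableSet B) :
    volume (chainSet k A B) = volume A * volume B ^ k := by
  induction k with
  | zero =>
    have : chainSet 0 A B = Set.univ.pi fun _ => A := by
      ext x
      simp [chainSet]
    rw [this, volume_pi_pi]
    simp
  | succ k ih =>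
    have he := (volume_preserving_piFinSuccAbove (fun _ : Fin (k + 2) => Plane) (Fin.last _))
    set S : Set (Plane × (Fin (k + 1) → Plane)) :=
      {p | p.2 ∈ chainSet k A B ∧ p.1 - p.2 (Fin.last k) ∈ B} with hS
    have hSm : MeasurableSet S :=
      (measurable_snd (measurableSet_chainSet k hA hB)).inter
        ((by fun_prop : Measurable fun p : Plane × (Fin (k + 1) → Plane) =>
          p.1 - p.2 (Fin.last k)) hB)
    have hpre : chainSet (k + 1) A B =
        (MeasurableEquiv.piFinSuccAbove (fun _ : Fin (k + 2) => Plane) (Fin.last _)) ⁻¹' S := by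
      ext x
      rw [mem_chainSet_succ_iff]
      simp [hS, MeasurableEquiv.piFinSuccAbove, Fin.init_def]
    rw [hpre, he.measure_preimage hSm.nullMeasurableSet, Measure.volume_eq_prod,
      Measure.prod_apply_symm hSm]
    have hslice : ∀ y : Fin (k + 1) → Plane, volume ((fun x => (x, y)) ⁻¹' S) =
        (chainSet k A B).indicator (fun _ => volume B) y := fun y => by
      by_cases hy : y ∈ chainSet k A B
      · rw [Set.indicator_of_mem hy]
        have : (fun x => (x, y)) ⁻¹' S = (fun x => x - y (Fin.last k)) ⁻¹' B := by
          ext x; simp [hS, hy]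
        simp_rw [this, sub_eq_add_neg]
        exact measure_preimage_add_right _ _ _
      · rw [Set.indicator_of_notMem hy]
        have : (fun x => (x, y)) ⁻¹' S = ∅ := by
          ext x; simp [hS, hy]
        rw [this, measure_empty]
    simp_rw [hslice]
    rw [lintegral_indicator_const (measurableSet_chainSet k hA hB), ih]
    ring

/-- The triples in the ball of radius `R` whose first point is equidistant from the other two. -/
def tieSet (R : ℝ) : Set (Fin 3 → Plane) :=
  {x | (∀ i, x i ∈ Metric.closedBall 0 R) ∧ dist (x 0) (x 1) = dist (x 0) (x 2)}

theorem isCompact_tieSet (R : ℝ) : IsCompact (tieSet R) := by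
  refine (isCompact_univ_pi fun _ : Fin 3 => isCompact_closedBall (0 : Plane) R).of_isClosed_subset
    ?_ fun x hx i _ => hx.1 i
  have : tieSet R = (Set.univ.pi fun _ => Metric.closedBall 0 R) ∩
      {x | dist (x 0) (x 1) = dist (x 0) (x 2)} := by
    ext x; simp [tieSet]
  rw [this]
  exact (isClosed_set_pi fun _ _ => Metric.isClosed_closedBall).inter
    (isClosed_eq (by fun_prop) (by fun_prop))

theorem volume_tieSet (R : ℝ) : volume (tieSet R) = 0 := by
  have he := (volume_preserving_piFinSuccAbove (fun _ : Fin 3 => Plane) (Fin.last _))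
  set S : Set (Plane × (Fin 2 → Plane)) := {p | dist (p.2 0) (p.2 1) = dist (p.2 0) p.1} with hS
  have hSm : MeasurableSet S :=
    (isClosed_eq (by fun_prop) (by fun_prop)).measurableSet
  have hpre : tieSet R ⊆
      (MeasurableEquiv.piFinSuccAbove (fun _ : Fin 3 => Plane) (Fin.last _)) ⁻¹' S := by
    intro x hx
    exact hx.2
  refine measure_mono_null hpre ?_
  rw [he.measure_preimage hSm.nullMeasurableSet, Measure.volume_eq_prod,
      Measure.prod_apply_symm hSm]
  have hslice : ∀ y : Fin 2 → Plane, volume ((fun x => (x, y)) ⁻¹' S) = 0 := fun y => by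
    have : (fun x => (x, y)) ⁻¹' S = Metric.sphere (y 0) (dist (y 0) (y 1)) := by
      ext x; simp only [hS, Set.mem_preimage, Set.mem_ofPred_eq, Metric.mem_sphere, dist_comm x]; exact eq_comm
    rw [this, Measure.addHaar_sphere]
  simp [hslice]

/-- The `j`-th of the concentric closed annuli that are bounded by the circles of radius `√j * s`;
they all have area `π * s ^ 2`. -/
def annulus (s : ℝ) (j : ℕ) : Set Plane :=
  Metric.closedBall 0 (√(j + 1) * s) \ Metric.ball 0 (√j * s)

theorem isCompact_annulus (s : ℝ) (j : ℕ) : IsCompact (annulus s j) :=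
  (isCompact_closedBall _ _).diff Metric.isOpen_ball

theorem mem_annulus_floor {s : ℝ} (hs : 0 < s) (x : Plane) : x ∈ annulus s ⌊(‖x‖ / s) ^ 2⌋₊ := by
  have h0 : 0 ≤ ‖x‖ / s := by positivity
  refine ⟨?_, ?_⟩
  · rw [mem_closedBall_zero_iff, ← div_le_iff₀ hs]
    exact Real.le_sqrt_of_sq_le (Nat.lt_floor_add_one _).le
  · rw [mem_ball_zero_iff, not_lt, ← le_div_iff₀ hs]
    exact Real.sqrt_le_iff.2 ⟨h0, Nat.floor_le (by positivity)⟩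

theorem volume_annulus {s : ℝ} (hs : 0 ≤ s) (j : ℕ) :
    volume (annulus s j) = ENNReal.ofReal (Real.pi * s ^ 2) := by
  have hj : √(j : ℝ) * s ≤ √(j + 1) * s := by gcongr; linarith
  have h1 : (√((j : ℝ) + 1)) ^ 2 = j + 1 := Real.sq_sqrt (by positivity)
  have h2 : (√(j : ℝ)) ^ 2 = j := Real.sq_sqrt (by positivity)
  rw [annulus, measure_sdiff (Metric.ball_subset_closedBall.trans
    (Metric.closedBall_subset_closedBall hj))
    measurableSet_ball.nullMeasurableSet measure_ball_lt_top.ne,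
    EuclideanSpace.volume_closedBall_fin_two, EuclideanSpace.volume_ball_fin_two,
    ← ENNReal.ofReal_pow (by positivity), ← ENNReal.ofReal_pow (by positivity),
    ← ENNReal.ofReal_mul (by positivity), ← ENNReal.ofReal_mul (by positivity),
    ← ENNReal.ofReal_sub _ (by positivity)]
  congr 1
  rw [mul_pow, mul_pow, h1, h2]
  ring

/-! ### Measurability of the backward and forward sets -/

namespace Config

variable {X : Type*} [MeasurableSpace X]

theorem encard_inter_eq_kernel {f : X → Config} (hf : Measurable f) {S : Set (X × Plane)}
    (hS : MeasurableSet S) (p : X) :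
    (((f p).carrier ∩ {w | (p, w) ∈ S}).encard : ℝ≥0∞) =
      countingKernel.comap f hf p (Prod.mk p ⁻¹' S) := by
  rw [Kernel.comap_apply, countingKernel_apply,
    toMeasure_apply _ (measurable_prodMk_left hS)]
  rfl

theorem measurable_encard_inter {f : X → Config} (hf : Measurable f) {S : Set (X × Plane)}
    (hS : MeasurableSet S) :
    Measurable fun p => (((f p).carrier ∩ {w | (p, w) ∈ S}).encard : ℝ≥0∞) := by
  simp_rw [encard_inter_eq_kernel hf hS]
  exact Kernel.measurable_kernel_prodMk_left hS

theorem measurableSet_exists_mem_carrier {f : X → Config} (hf : Measurable f) {S : Set (X × Plane)}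
    (hS : MeasurableSet S) : MeasurableSet {p | ∃ w ∈ (f p).carrier, (p, w) ∈ S} := by
  have : {p | ∃ w ∈ (f p).carrier, (p, w) ∈ S} =
      (fun p => (((f p).carrier ∩ {w | (p, w) ∈ S}).encard : ℝ≥0∞)) ⁻¹' {0}ᶜ := by
    ext p
    simp [Set.eq_empty_iff_forall_notMem]
  rw [this]
  exact measurable_encard_inter hf hS (measurableSet_singleton _).compl

theorem measurableSet_finite_inter {f : X → Config} (hf : Measurable f) {S : Set (X × Plane)}
    (hS : MeasurableSet S) : MeasurableSet {p | ((f p).carrier ∩ {w | (p, w) ∈ S}).Finite} := by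
  have : {p | ((f p).carrier ∩ {w | (p, w) ∈ S}).Finite} =
      (fun p => (((f p).carrier ∩ {w | (p, w) ∈ S}).encard : ℝ≥0∞)) ⁻¹' {∞}ᶜ := by
    ext p
    simp
  rw [this]
  exact measurable_encard_inter hf hS (measurableSet_singleton _).compl

theorem measurableSet_mem_carrier {f : X → Config} (hf : Measurable f) {g : X → Plane}
    (hg : Measurable g) : MeasurableSet {p | g p ∈ (f p).carrier} := by
  have : {p | g p ∈ (f p).carrier} =
      {p | ∃ w ∈ (f p).carrier, (p, w) ∈ {q : X × Plane | q.2 = g q.1}} := by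
    ext p; simp
  rw [this]
  exact measurableSet_exists_mem_carrier hf
    (measurableSet_eq_fun measurable_snd (hg.comp measurable_fst))

theorem measurableSet_follows {f : X → Config} (hf : Measurable f) {g h : X → Plane}
    (hg : Measurable g) (hh : Measurable h) : MeasurableSet {p | (f p).Follows (g p) (h p)} := by
  have hS : MeasurableSet {q : X × Plane | q.2 ≠ g q.1 ∧ dist (g q.1) q.2 < dist (g q.1) (h q.1)} :=
    (measurableSet_eq_fun measurable_snd (hg.comp measurable_fst)).compl.inter
      (measurableSet_lt ((hg.comp measurable_fst).dist measurable_snd)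
        ((hg.comp measurable_fst).dist (hh.comp measurable_fst)))
  have : {p | (f p).Follows (g p) (h p)} = {p | g p ∈ (f p).carrier} ∩ ({p | h p ∈ (f p).carrier} ∩
      ({p | h p = g p}ᶜ ∩ {p | ∃ w ∈ (f p).carrier, (p, w) ∈
        {q : X × Plane | q.2 ≠ g q.1 ∧ dist (g q.1) q.2 < dist (g q.1) (h q.1)}}ᶜ)) := by
    ext p
    simp [Follows]
  rw [this]
  exact (measurableSet_mem_carrier hf hg).inter ((measurableSet_mem_carrier hf hh).inter
    ((measurableSet_eq_fun hh hg).compl.inter (measurableSet_exists_mem_carrier hf hS).compl))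

theorem Follows.left_mem {η : Config} {x y : Plane} (h : η.Follows x y) : x ∈ η.carrier := h.1

theorem Follows.right_mem {η : Config} {x y : Plane} (h : η.Follows x y) : y ∈ η.carrier := h.2.1

/-- `η.Reaches k x y`: there is a chain of `k` points, each following the next one, from `x` to
`y`. -/
def Reaches (η : Config) : ℕ → Plane → Plane → Prop
  | 0, x, y => x = y
  | k + 1, x, y => ∃ w ∈ η.carrier, η.Reaches k x w ∧ η.Follows w y

theorem reflTransGen_iff_exists_reaches {η : Config} {x y : Plane} :
    Relation.ReflTransGen η.Follows x y ↔ ∃ k, η.Reaches k x y := by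
  constructor
  · intro h
    induction h with
    | refl => exact ⟨0, rfl⟩
    | tail _ hwy ih =>
      obtain ⟨k, hk⟩ := ih
      exact ⟨k + 1, _, hwy.left_mem, hk, hwy⟩
  · rintro ⟨k, hk⟩
    induction k generalizing y with
    | zero => exact hk ▸ .refl
    | succ k ih =>
      obtain ⟨w, _, hw, hwy⟩ := hk
      exact (ih hw).tail hwy

theorem measurableSet_reaches (k : ℕ) :
    MeasurableSet {p : Config × Plane × Plane | p.1.Reaches k p.2.1 p.2.2} := by
  induction k with
  | zero => exact measurableSet_eq_fun measurable_snd.fst measurable_snd.snd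
  | succ k ih =>
    have hS : MeasurableSet {q : (Config × Plane × Plane) × Plane |
        q.1.1.Reaches k q.1.2.1 q.2 ∧ q.1.1.Follows q.2 q.1.2.2} :=
      ((by fun_prop : Measurable fun q : (Config × Plane × Plane) × Plane =>
        (q.1.1, q.1.2.1, q.2)) ih).inter
        (measurableSet_follows (by fun_prop) (by fun_prop) (by fun_prop))
    exact measurableSet_exists_mem_carrier measurable_fst hS

theorem measurableSet_reflTransGen_follows :
    MeasurableSet {p : Config × Plane × Plane | Relation.ReflTransGen p.1.Follows p.2.1 p.2.2} := by
  simp_rw [reflTransGen_iff_exists_reaches, Set.ofPred_exists]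
  exact MeasurableSet.iUnion measurableSet_reaches

theorem finite_iff_finite_carrier_inter {η : Config} {T : Set Plane}
    (hT : T ⊆ insert 0 η.carrier) : T.Finite ↔ (η.carrier ∩ T).Finite := by
  refine ⟨fun h => h.subset Set.inter_subset_right, fun h => (h.insert 0).subset fun y hy => ?_⟩
  rcases hT hy with h0 | h1
  · exact Or.inl h0
  · exact Or.inr ⟨h1, hy⟩

theorem forwardSet_subset (η : Config) (x : Plane) : η.forwardSet x ⊆ insert x η.carrier := by
  intro y hy
  rcases Relation.ReflTransGen.cases_tail hy with h | ⟨w, _, h⟩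
  · exact Or.inl h
  · exact Or.inr h.right_mem

theorem backwardSet_subset (η : Config) (x : Plane) : η.backwardSet x ⊆ insert x η.carrier := by
  intro y hy
  rcases Relation.ReflTransGen.cases_head hy with h | ⟨w, h, _⟩
  · exact Or.inl h
  · exact Or.inr h.left_mem

theorem measurableSet_finite_forwardSet_backwardSet :
    MeasurableSet {η : Config | (η.forwardSet 0).Finite ∧ (η.backwardSet 0).Finite} := by
  have hF : MeasurableSet {η : Config | (η.forwardSet 0).Finite} := by
    simp_rw [finite_iff_finite_carrier_inter (forwardSet_subset _ 0)]
    exact measurableSet_finite_inter measurable_id (S := {q : Config × Plane |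
      Relation.ReflTransGen q.1.Follows 0 q.2})
      ((by fun_prop : Measurable fun q : Config × Plane => (q.1, (0 : Plane), q.2))
        measurableSet_reflTransGen_follows)
  have hB : MeasurableSet {η : Config | (η.backwardSet 0).Finite} := by
    simp_rw [finite_iff_finite_carrier_inter (backwardSet_subset _ 0)]
    exact measurableSet_finite_inter measurable_id (S := {q : Config × Plane |
      Relation.ReflTransGen q.1.Follows q.2 0})
      ((by fun_prop : Measurable fun q : Config × Plane => (q.1, q.2, (0 : Plane)))
        measurableSet_reflTransGen_follows)
  exact hF.inter hB

/-! ### Translation and components -/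

theorem shift_follows_iff {η : Config} {x a b : Plane} :
    (η.shift x).Follows a b ↔ η.Follows (a + x) (b + x) := by
  have hmem : ∀ c, c ∈ (η.shift x).carrier ↔ c + x ∈ η.carrier := fun c => by
    simp [shift, sub_eq_iff_eq_add]
  unfold Follows
  rw [hmem, hmem]
  refine and_congr_right fun _ => and_congr_right fun _ => and_congr (by simp) ?_
  constructor
  · intro h z hz hne
    have := h (z - x) ((hmem _).2 (by simpa using hz)) (by rwa [ne_eq, sub_eq_iff_eq_add])
    rwa [dist_add_right, ← dist_add_right a (z - x) x, sub_add_cancel] at *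
  · intro h z hz hne
    have := h (z + x) ((hmem _).1 hz) (by simpa using hne)
    rwa [dist_add_right, dist_add_right] at this

theorem reflTransGen_of_shift {η : Config} {x a b : Plane}
    (h : Relation.ReflTransGen (η.shift x).Follows a b) :
    Relation.ReflTransGen η.Follows (a + x) (b + x) :=
  h.lift (· + x) fun _ _ => shift_follows_iff.1

theorem Follows.adj {η : Config} {x y : Plane} (h : η.Follows x y) :
    η.nnGraph.Adj ⟨x, h.left_mem⟩ ⟨y, h.right_mem⟩ :=
  (SimpleGraph.fromRel_adj _ _ _).2 ⟨fun e => h.2.2.1 (congrArg Subtype.val e).symm, Or.inl h⟩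

theorem reachable_of_reflTransGen {η : Config} {x y : Plane} (hx : x ∈ η.carrier)
    (h : Relation.ReflTransGen η.Follows x y) :
    ∃ hy : y ∈ η.carrier, η.nnGraph.Reachable ⟨x, hx⟩ ⟨y, hy⟩ := by
  induction h with
  | refl => exact ⟨hx, .refl _⟩
  | tail _ hwy ih =>
    obtain ⟨_, hr⟩ := ih
    exact ⟨hwy.right_mem, hr.trans hwy.adj.reachable⟩

/-- If the components of the nearest neighbour graph are finite, then, seen from each of the points,
the forward and backward sets of the origin are finite. -/
theorem finite_forwardSet_backwardSet_shift {η : Config}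
    (h : ∀ C : η.nnGraph.ConnectedComponent, C.supp.Finite) {x : Plane} (hx : x ∈ η.carrier) :
    ((η.shift x).forwardSet 0).Finite ∧ ((η.shift x).backwardSet 0).Finite := by
  have hfin := ((h (η.nnGraph.connectedComponentMk ⟨x, hx⟩)).image Subtype.val).image (· - x)
  constructor
  · refine hfin.subset fun y hy => ?_
    have h1 := reflTransGen_of_shift hy
    rw [zero_add] at h1
    obtain ⟨hy', hr⟩ := reachable_of_reflTransGen hx h1
    exact ⟨y + x, ⟨⟨_, hy'⟩, SimpleGraph.ConnectedComponent.sound hr.symm, rfl⟩, by simp⟩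
  · refine hfin.subset fun y hy => ?_
    have h1 := reflTransGen_of_shift hy
    rw [zero_add] at h1
    have hy' : y + x ∈ η.carrier := by
      rcases backwardSet_subset η x h1 with h2 | h2
      · rwa [h2]
      · exact h2
    obtain ⟨_, hr⟩ := reachable_of_reflTransGen hy' h1
    exact ⟨y + x, ⟨⟨_, hy'⟩, SimpleGraph.ConnectedComponent.sound hr, rfl⟩, by simp⟩

end Config

/-! ### Passage to the Palm probability -/

/-- An event of probability one for the configurations seen from all the points of the process has
Palm probability one. -/
theorem ae_palm_of_ae_forall_shift {Ω : Type*} [MeasurableSpace Ω] {P : Measure Ω} [SFinite P]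
    {Φ : Ω → Config} (hΦ : Measurable Φ) {A : Set Config} (hA : MeasurableSet A)
    (h : ∀ᵐ ω ∂P, ∀ x ∈ (Φ ω).carrier, (Φ ω).shift x ∈ A) : ∀ᵐ η ∂(palm (P.map Φ)), η ∈ A := by
  have hm : MeasurableSet {η : Config | ∀ x ∈ η.carrier, η.shift x ∈ A} := by
    have := (Config.measurableSet_exists_mem_carrier measurable_id
      (Config.measurable_shift hA.compl)).compl
    convert this using 1
    ext η
    simp
  have h' : ∀ᵐ η ∂(P.map Φ), ∀ x ∈ η.carrier, η.shift x ∈ A := (ae_map_iff hΦ.aemeasurable hm).2 h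
  rw [ae_iff]
  change palm _ Aᶜ = 0
  rw [palm_apply _ hA.compl]
  refine mul_eq_zero_of_right _ ((lintegral_congr_ae ?_).trans lintegral_zero)
  filter_upwards [h'] with η hη
  have : η.carrier ∩ {x | x ∈ unitSquare ∧ η.shift x ∈ Aᶜ} = ∅ := by
    ext x
    simpa using fun hx _ => hη x hx
  rw [this]
  simp

/-! ### Paths of the nearest neighbour graph -/

theorem exists_constant_run_of_monotone {f : ℕ → ℕ} {a J k : ℕ} (hJ : 0 < J) (hk : 0 < k)
    (hmono : ∀ i j, a ≤ i → i ≤ j → j < a + J * k → f i ≤ f j)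
    (hlt : ∀ i, a ≤ i → i < a + J * k → f i < J) :
    ∃ q, a ≤ q ∧ q + k ≤ a + J * k ∧ ∀ i, q ≤ i → i < q + k → f i = f q := by
  by_contra! hcon
  have hle : ∀ t < J, t * k + k ≤ J * k := fun t ht => by
    have := Nat.mul_le_mul_right k (Nat.succ_le_of_lt ht)
    rwa [Nat.succ_mul] at this
  have hstep : ∀ t < J, f (a + t * k) < f (a + t * k + (k - 1)) := fun t ht => by
    have h1 := hle t ht
    obtain ⟨i, hi, hi', hne⟩ := hcon (a + t * k) (by omega) (by omega)
    have h2 := hmono (a + t * k) i (by omega) hi (by omega)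
    have h3 := hmono i (a + t * k + (k - 1)) (by omega) (by omega) (by omega)
    omega
  have key : ∀ t < J, t < f (a + t * k + (k - 1)) := fun t => by
    induction t with
    | zero => intro ht; have := hstep 0 ht; omega
    | succ t ih =>
      intro ht
      have h1 := ih (by omega)
      have h2 := hstep (t + 1) ht
      have h3 := hle (t + 1) ht
      have h4 : (t + 1) * k = t * k + k := Nat.succ_mul t k
      have h5 := hmono (a + t * k + (k - 1)) (a + (t + 1) * k) (by omega) (by omega) (by omega)
      omega
  have h1 := key (J - 1) (by omega)
  have h2 := hle (J - 1) (by omega)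
  have h3 := hlt (a + (J - 1) * k + (k - 1)) (by omega) (by omega)
  omega

theorem exists_constant_run_of_antitone {f : ℕ → ℕ} {a J k : ℕ} (hJ : 0 < J) (hk : 0 < k)
    (hanti : ∀ i j, a ≤ i → i ≤ j → j < a + J * k → f j ≤ f i)
    (hlt : ∀ i, a ≤ i → i < a + J * k → f i < J) :
    ∃ q, a ≤ q ∧ q + k ≤ a + J * k ∧ ∀ i, q ≤ i → i < q + k → f i = f q := by
  obtain ⟨q, h1, h2, h3⟩ := exists_constant_run_of_monotone (f := fun i => J - 1 - f i) hJ hk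
    (fun i j h h' h'' => Nat.sub_le_sub_left (hanti i j h h' h'') _) (fun i _ _ => by omega)
  refine ⟨q, h1, h2, fun i hi hi' => ?_⟩
  have h4 := h3 i hi hi'
  have h5 := hlt i (by omega) (by omega)
  have h6 := hlt q h1 (by omega)
  omega

namespace Config

variable {η : Config}

/-- Without ties, a self-avoiding path consists of steps from follower to leader, and then of steps
from leader to follower: otherwise some vertex would follow both its predecessor and its
successor. -/
theorem exists_turning_point (hT : ∀ x y z, η.Follows x y → η.Follows x z → y = z)
    {v : ℕ → Plane} {L : ℕ} (hv : ∀ i < L, η.Follows (v i) (v (i + 1)) ∨ η.Follows (v (i + 1)) (v i))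
    (hinj : Set.InjOn v (Set.Iic L)) :
    ∃ p ≤ L, (∀ i < p, η.Follows (v i) (v (i + 1))) ∧
      ∀ i, p ≤ i → i < L → η.Follows (v (i + 1)) (v i) := by
  induction L with
  | zero => exact ⟨0, le_rfl, by simp, by simp⟩
  | succ L ih =>
    obtain ⟨p, hp, h1, h2⟩ := ih (fun i hi => hv i (by omega))
      (hinj.mono (Set.Iic_subset_Iic.2 (by omega)))
    rcases hp.eq_or_lt with rfl | hpL
    · rcases hv p (by omega) with h | h
      · refine ⟨p + 1, le_rfl, fun i hi => ?_, fun i hi hi' => by omega⟩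
        rcases Nat.lt_succ_iff_lt_or_eq.1 hi with h' | rfl
        · exact h1 i h'
        · exact h
      · refine ⟨p, by omega, h1, fun i hi hi' => ?_⟩
        obtain rfl : i = p := by omega
        exact h
    · refine ⟨p, by omega, h1, fun i hi hi' => ?_⟩
      rcases Nat.lt_succ_iff_lt_or_eq.1 hi' with h' | rfl
      · exact h2 i hi h'
      · refine (hv i hi').resolve_left fun hf => ?_
        obtain ⟨m, rfl⟩ : ∃ m, i = m + 1 := ⟨i - 1, by omega⟩
        have h3 := hT _ _ _ (h2 m (by omega) (by omega)) hf
        have h4 := hinj (show m ∈ Set.Iic (m + 1 + 1) by simp; omega)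
          (show m + 1 + 1 ∈ Set.Iic (m + 1 + 1) by simp) h3
        omega

/-- If all discs of radius `r` with centre in the disc of radius `R + r` around the origin are
occupied, then the edges with an endpoint in the disc of radius `R` are shorter than `2 * r`. -/
theorem dist_lt_of_follows {R r : ℝ} (hr : 0 < r)
    (hV : ∀ c ∈ Metric.closedBall (0 : Plane) (R + r), ∃ w ∈ η.carrier, dist w c < r)
    {u v : Plane} (hu : ‖u‖ ≤ R) (h : η.Follows u v ∨ η.Follows v u) : dist u v < 2 * r := by
  by_contra! hD
  have hD0 : 0 < dist u v := by linarith
  -- the disc of radius `r` touching `u` on the side of `v`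
  set c := u + (r / dist u v) • (v - u) with hc
  have hcu : dist c u = r := by
    rw [hc, dist_eq_norm, add_sub_cancel_left, norm_smul, ← dist_eq_norm, dist_comm v u,
      Real.norm_of_nonneg (by positivity), div_mul_cancel₀ _ hD0.ne']
  have hcv : dist c v = dist u v - r := by
    have h1 : c - v = (1 - r / dist u v) • (u - v) := by rw [hc]; module
    rw [dist_eq_norm, h1, norm_smul, ← dist_eq_norm u v, Real.norm_of_nonneg, sub_mul,
      div_mul_cancel₀ _ hD0.ne', one_mul]
    rw [sub_nonneg, div_le_one hD0]
    linarith
  -- a point in this disc would be nearer to `u` than `2 * r`, and nearer to `v` than `u` is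
  obtain ⟨w, hw, hwc⟩ := hV c (by
    rw [mem_closedBall_zero_iff]
    have := norm_le_norm_add_norm_sub' c u
    rw [← dist_eq_norm] at this
    linarith)
  rcases h with h | h
  · have hne : w ≠ u := by rintro rfl; rw [dist_comm] at hwc; linarith
    have := h.2.2.2 w hw hne
    have := dist_triangle u c w
    rw [dist_comm u c, dist_comm c w] at this
    linarith
  · have hne : w ≠ v := by rintro rfl; rw [dist_comm] at hwc; linarith
    have := h.2.2.2 w hw hne
    have := dist_triangle v c w
    rw [dist_comm v c, dist_comm c w] at this
    rw [dist_comm v u] at *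
    linarith

/-- Without ties, a self-avoiding path with more than `2 * J * k` edges whose lengths belong to the
first `J` annuli contains `k` consecutive edges whose lengths belong to the same annulus, since the
lengths are first nonincreasing and then nondecreasing. -/
theorem exists_constant_run_of_path (hT : ∀ x y z, η.Follows x y → η.Follows x z → y = z)
    {v : ℕ → Plane} {L J k : ℕ} {s : ℝ} (hs : 0 < s) (hJ : 0 < J) (hk : 0 < k)
    (hv : ∀ i < L, η.Follows (v i) (v (i + 1)) ∨ η.Follows (v (i + 1)) (v i))
    (hinj : Set.InjOn v (Set.Iic L)) (hL : 2 * (J * k) ≤ L)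
    (hlt : ∀ i < L, ⌊(dist (v i) (v (i + 1)) / s) ^ 2⌋₊ < J) :
    ∃ q, q + k ≤ L ∧ ∀ i, q ≤ i → i < q + k →
      ⌊(dist (v i) (v (i + 1)) / s) ^ 2⌋₊ = ⌊(dist (v q) (v (q + 1)) / s) ^ 2⌋₊ := by
  obtain ⟨p, hp, hf, hb⟩ := exists_turning_point hT hv hinj
  have hfloor : ∀ {a b : ℝ}, 0 ≤ a → a ≤ b → ⌊(a / s) ^ 2⌋₊ ≤ ⌊(b / s) ^ 2⌋₊ := fun ha hab => by
    gcongr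
  by_cases hpJ : J * k ≤ p
  · obtain ⟨q, _, hq, hc⟩ := exists_constant_run_of_antitone (a := 0)
      (f := fun i => ⌊(dist (v i) (v (i + 1)) / s) ^ 2⌋₊) hJ hk
      (fun i j _ hij hj => by
        refine hfloor dist_nonneg ?_
        induction j, hij using Nat.le_induction with
        | base => exact le_rfl
        | succ j hij ih =>
          refine le_trans ?_ (ih (by omega))
          have h1 := hf j (by omega)
          rw [dist_comm (v j)]
          exact (hf (j + 1) (by omega)).2.2.2 _ h1.left_mem h1.2.2.1.symm)
      (fun i _ hi => hlt i (by omega))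
    exact ⟨q, by omega, hc⟩
  · obtain ⟨q, _, hq, hc⟩ := exists_constant_run_of_monotone (a := p)
      (f := fun i => ⌊(dist (v i) (v (i + 1)) / s) ^ 2⌋₊) hJ hk
      (fun i j hi hij hj => by
        refine hfloor dist_nonneg ?_
        induction j, hij using Nat.le_induction with
        | base => exact le_rfl
        | succ j hij ih =>
          refine (ih (by omega)).trans ?_
          have h1 := hb (j + 1) (by omega) (by omega)
          rw [dist_comm (v j)]
          exact (hb j (by omega) (by omega)).2.2.2 _ h1.left_mem h1.2.2.1.symm)
      (fun i _ hi => hlt i (by omega))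
    exact ⟨q, by omega, hc⟩

/-- `η` contains `k + 1` distinct points, the first of them in the disc of radius `R` around the
origin, whose increments all belong to the same one of the first `J` annuli. -/
def HasChain (η : Config) (R s : ℝ) (J k : ℕ) : Prop :=
  ∃ j < J, ∃ x : Fin (k + 1) → Plane, Function.Injective x ∧ (∀ i, x i ∈ η.carrier) ∧
    x ∈ chainSet k (Metric.closedBall 0 R) (annulus s j)

/-- All discs of radius `r` with centre in the disc of radius `R` around the origin are occupied. -/
def NoVoid (η : Config) (R r : ℝ) : Prop :=
  ∀ c ∈ Metric.closedBall (0 : Plane) R, ∃ w ∈ η.carrier, dist w c < r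

/-- Components do not leave a disc in which there are neither large voids nor chains of steps of
almost equal lengths: a path leaving the disc would have many edges. -/
theorem norm_le_of_reachable (hT : ∀ x y z, η.Follows x y → η.Follows x z → y = z)
    {R₀ R r s : ℝ} {J k : ℕ} (hr : 0 < r) (hs : 0 < s) (hk : 0 < k) (hJ : (2 * r / s) ^ 2 ≤ J)
    (hR : R₀ + 2 * r * (2 * (J * k)) ≤ R) (hV : η.NoVoid (R + r) r) (hC : ¬ η.HasChain R s J k)
    {x y : η.carrier} (hx : ‖(x : Plane)‖ ≤ R₀) (hxy : η.nnGraph.Reachable x y) :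
    ‖(y : Plane)‖ ≤ R := by
  classical
  by_contra! hy
  have hJ0 : 0 < J := by
    have : 0 < (2 * r / s) ^ 2 := by positivity
    exact_mod_cast this.trans_le hJ
  obtain ⟨p, hp⟩ := hxy.exists_isPath
  set v : ℕ → Plane := fun i => (p.getVert i : Plane) with hv
  have hex : ∃ i, i ≤ p.length ∧ R < ‖v i‖ := ⟨p.length, le_rfl, by simpa [hv] using hy⟩
  -- the first vertex outside the disc
  set L := Nat.find hex with hL
  obtain ⟨hLp, hLR⟩ := Nat.find_spec hex
  have hlt : ∀ i < L, ‖v i‖ ≤ R := fun i hi => by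
    have := Nat.find_min hex hi
    push Not at this
    exact this (by omega)
  have hadj : ∀ i < L, η.Follows (v i) (v (i + 1)) ∨ η.Follows (v (i + 1)) (v i) := fun i hi =>
    ((SimpleGraph.fromRel_adj _ _ _).1 (p.adj_getVert_succ (by omega))).2
  have hinj : Set.InjOn v (Set.Iic L) := fun i hi j hj hij =>
    hp.getVert_injOn (le_trans hi hLp) (le_trans hj hLp) (Subtype.ext hij)
  have hlen : ∀ i < L, dist (v i) (v (i + 1)) < 2 * r := fun i hi =>
    dist_lt_of_follows hr hV (hlt i hi) (hadj i hi)
  have hgrow : ∀ i ≤ L, ‖v i‖ ≤ R₀ + 2 * r * i := fun i => by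
    induction i with
    | zero => intro _; simpa [hv] using hx
    | succ i ih =>
      intro hi
      have h1 := ih (by omega)
      have h2 := hlen i (by omega)
      have h3 := norm_le_norm_add_norm_sub' (v (i + 1)) (v i)
      rw [← dist_eq_norm, dist_comm] at h3
      push_cast
      linarith
  have hlong : 2 * (J * k) ≤ L := by
    have h1 := hgrow L le_rfl
    have h2 : 2 * r * (2 * (J * k)) < 2 * r * L := by linarith
    have h3 := lt_of_mul_lt_mul_left h2 (by positivity)
    exact_mod_cast h3.le
  have hclass : ∀ i < L, ⌊(dist (v i) (v (i + 1)) / s) ^ 2⌋₊ < J := fun i hi => by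
    rw [Nat.floor_lt (by positivity)]
    refine lt_of_lt_of_le ?_ hJ
    have := hlen i hi
    gcongr
  obtain ⟨q, hq, hc⟩ := exists_constant_run_of_path hT hs hJ0 hk hadj hinj hlong hclass
  refine hC ⟨_, hclass q (by omega), fun i => v (q + i), ?_, fun i => (p.getVert _).2, ?_, ?_⟩
  · intro i j hij
    have h1 := hinj (show q + (i : ℕ) ∈ Set.Iic L by simp; omega)
      (show q + (j : ℕ) ∈ Set.Iic L by simp; omega) hij
    exact Fin.ext (by omega)
  · simpa using hlt q (by omega)
  · intro i
    have h1 := mem_annulus_floor hs (v (q + i + 1) - v (q + i))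
    rw [← dist_eq_norm, dist_comm, hc (q + i) (by omega) (by omega)] at h1
    exact h1

end Config

/-! ### Probability estimates -/

namespace IsHomogeneousPoisson

variable {Ω : Type*} [MeasurableSpace Ω] {P : Measure Ω}
  {Φ : Ω → Config} {lam : ℝ≥0}

theorem ae_unique_leader [IsProbabilityMeasure P]
    (hΦ : IsHomogeneousPoisson P Φ lam) :
    ∀ᵐ ω ∂P, ∀ x y z, (Φ ω).Follows x y → (Φ ω).Follows x z → y = z := by
  have h0 : ∀ m : ℕ, ∀ᵐ ω ∂P, ¬ ∃ x : Fin 3 → Plane, Function.Injective x ∧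
      (∀ i, x i ∈ (Φ ω).carrier) ∧ x ∈ tieSet m := fun m => by
    rw [ae_iff]
    simp only [not_not]
    have := hΦ.measure_exists_injective_mem_le (isCompact_tieSet m)
    rwa [volume_tieSet, mul_zero, nonpos_iff_eq_zero] at this
  filter_upwards [ae_all_iff.2 h0] with ω hω x y z hy hz
  by_contra hyz
  obtain ⟨m, hm⟩ := exists_nat_ge (max ‖x‖ (max ‖y‖ ‖z‖))
  refine hω m ⟨![x, y, z], ?_, ?_, ?_, ?_⟩
  · intro i j hij
    have h1 := hy.2.2.1
    have h2 := hz.2.2.1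
    fin_cases i <;> fin_cases j <;> simp_all [eq_comm]
  · intro i
    fin_cases i
    exacts [hy.left_mem, hy.right_mem, hz.right_mem]
  · intro i
    simp only [max_le_iff] at hm
    rw [mem_closedBall_zero_iff]
    fin_cases i
    exacts [hm.1, hm.2.1, hm.2.2]
  · exact le_antisymm (hy.2.2.2 _ hz.right_mem hz.2.2.1) (hz.2.2.2 _ hy.right_mem hy.2.2.1)

theorem measure_hasChain_le [IsProbabilityMeasure P]
    (hΦ : IsHomogeneousPoisson P Φ lam) {R s : ℝ} (hR : 0 ≤ R) (hs : 0 ≤ s)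
    (J k : ℕ) : P {ω | (Φ ω).HasChain R s J k} ≤
      ENNReal.ofReal (J * (lam * (R ^ 2 * Real.pi)) * (lam * (Real.pi * s ^ 2)) ^ k) := by
  have hsub : {ω | (Φ ω).HasChain R s J k} ⊆ ⋃ j ∈ Finset.range J,
      {ω | ∃ x : Fin (k + 1) → Plane, Function.Injective x ∧ (∀ i, x i ∈ (Φ ω).carrier) ∧
        x ∈ chainSet k (Metric.closedBall 0 R) (annulus s j)} := by
    rintro ω ⟨j, hj, hx⟩
    exact Set.mem_iUnion₂.2 ⟨j, Finset.mem_range.2 hj, hx⟩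
  refine (measure_mono hsub).trans ((measure_biUnion_finset_le _ _).trans ?_)
  refine (Finset.sum_le_sum fun j _ => hΦ.measure_exists_injective_mem_le
    (isCompact_chainSet k (isCompact_closedBall 0 R) (isCompact_annulus s j))).trans_eq ?_
  simp_rw [volume_chainSet k measurableSet_closedBall (isCompact_annulus s _).measurableSet,
    volume_annulus hs, EuclideanSpace.volume_closedBall_fin_two]
  rw [Finset.sum_const, Finset.card_range, nsmul_eq_mul,
    ENNReal.ofReal_mul (q := (lam * (Real.pi * s ^ 2)) ^ k) (by positivity),
    ENNReal.ofReal_mul (p := J) (by positivity), ENNReal.ofReal_mul (p := lam) (by positivity),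
    ENNReal.ofReal_mul (p := R ^ 2) (by positivity), ENNReal.ofReal_pow hR,
    ENNReal.ofReal_pow (p := lam * (Real.pi * s ^ 2)) (by positivity),
    ENNReal.ofReal_mul (p := lam) (by positivity), ENNReal.ofReal_natCast,
    ENNReal.ofReal_coe_nnreal]
  ring

/-- A large void contains an empty grid cell of side `r / 2`. -/
theorem measure_not_noVoid_le (hΦ : IsHomogeneousPoisson P Φ lam) {R r : ℝ} {m : ℕ}
    (hr : 0 < r) (hm : R ≤ r / 2 * m) :
    P {ω | ¬ (Φ ω).NoVoid R r} ≤
      ENNReal.ofReal ((2 * m + 1) ^ 2 * Real.exp (-(lam * (r / 2) ^ 2))) := by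
  have hr2 : 0 < r / 2 := by positivity
  set Z : Finset (Fin 2 → ℤ) := Fintype.piFinset fun _ => Finset.Icc (-(m : ℤ)) m with hZ
  have hsub : {ω | ¬ (Φ ω).NoVoid R r} ⊆
      ⋃ z ∈ Z, {ω | (Φ ω).toMeasure (gridCell (r / 2) z) = 0} := by
    intro ω hω
    simp only [Set.mem_ofPred_eq, Config.NoVoid, not_forall, not_exists, not_and, not_lt] at hω
    obtain ⟨c, hc, hw⟩ := hω
    refine Set.mem_iUnion₂.2 ⟨gridIndex (r / 2) c, ?_, ?_⟩
    · refine Fintype.mem_piFinset.2 fun i => ?_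
      have h1 : |c i| ≤ r / 2 * m := by
        have := PiLp.norm_apply_le c i
        rw [mem_closedBall_zero_iff] at hc
        rw [Real.norm_eq_abs] at this
        linarith
      rw [abs_le] at h1
      refine Finset.mem_Icc.2 ⟨Int.le_floor.2 ?_, Int.floor_le_iff.2 ?_⟩
      · rw [le_div_iff₀ hr2]; push_cast; linarith
      · rw [div_lt_iff₀ hr2]; push_cast; linarith
    · rw [Set.mem_ofPred_eq, Config.toMeasure_apply _ (measurableSet_gridCell _ _)]
      have : (Φ ω).carrier ∩ gridCell (r / 2) (gridIndex (r / 2) c) = ∅ := by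
        refine Set.eq_empty_iff_forall_notMem.2 fun w hwc => ?_
        have h1 := hw w hwc.1
        have h2 := dist_le_of_mem_gridCell hr2 hwc.2 (mem_gridCell_gridIndex _ c)
        linarith
      simp [this]
  refine (measure_mono hsub).trans ((measure_biUnion_finset_le _ _).trans_eq ?_)
  have hcell : ∀ z, P {ω | (Φ ω).toMeasure (gridCell (r / 2) z) = 0} =
      ENNReal.ofReal (Real.exp (-(lam * (r / 2) ^ 2))) := fun z => by
    rw [hΦ.measure_void (measurableSet_gridCell _ _)
      (by rw [volume_gridCell hr2]; exact ENNReal.ofReal_ne_top), volume_gridCell hr2,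
      ENNReal.toReal_ofReal (by positivity)]
  have hcard : Z.card = (2 * m + 1) ^ 2 := by
    rw [hZ, Fintype.card_piFinset]
    simp only [Int.card_Icc, Finset.prod_const, Finset.card_univ, Fintype.card_fin]
    congr 1
    omega
  simp_rw [hcell]
  rw [Finset.sum_const, hcard, nsmul_eq_mul, ENNReal.ofReal_mul (by positivity)]
  congr 1
  rw [← ENNReal.ofReal_natCast]
  push_cast
  rfl

open Filter Topology in
/-- Almost surely there are arbitrarily large scales `N` at which the hypotheses of
`Config.norm_le_of_reachable` hold. The radius of the disc is polynomial in `N`, whereas chains of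
`N` steps and voids of size `N` have exponentially small probability. -/
theorem ae_frequently_noVoid_not_hasChain [IsProbabilityMeasure P]
    (hΦ : IsHomogeneousPoisson P Φ lam) (hlam : 0 < lam)
    {S : ℕ} (hS : 0 < S) (hlS : (lam : ℝ) * (Real.pi * (1 / S) ^ 2) ≤ 1 / 2) :
    ∀ᵐ ω ∂P, ∃ᶠ N : ℕ in atTop, 0 < N ∧
      (Φ ω).NoVoid (17 * S ^ 2 * N ^ 4 + N) N ∧
      ¬ (Φ ω).HasChain (17 * S ^ 2 * N ^ 4) (1 / S) (4 * N ^ 2 * S ^ 2) N := by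
  -- paths from the disc of radius `N` to the circle of radius `17 * S ^ 2 * N ^ 4` have at least
  -- `2 * (4 * N ^ 2 * S ^ 2) * N` edges, and `4 * N ^ 2 * S ^ 2` annuli cover the disc of radius
  -- `2 * N`
  set E : ℕ → Set Ω := fun N => {ω | ¬ (Φ ω).NoVoid (17 * S ^ 2 * N ^ 4 + N) N} ∪
    {ω | (Φ ω).HasChain (17 * S ^ 2 * N ^ 4) (1 / S) (4 * N ^ 2 * S ^ 2) N} with hE
  set q : ℝ := Real.exp (-(lam / 4)) with hq
  have hq1 : q < 1 := by
    have : (0 : ℝ) < lam := hlam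
    rw [hq, Real.exp_lt_one_iff]
    linarith
  set C₁ : ℝ := (73 * S ^ 2) ^ 2
  set C₂ : ℝ := 4 * S ^ 2 * (lam * ((17 * S ^ 2) ^ 2 * Real.pi))
  set b : ℕ → ℝ := fun N => C₁ * (N ^ 6 * q ^ N) + C₂ * (N ^ 10 * (1 / 2) ^ N) with hb
  have hS1 : (1 : ℝ) ≤ S := by exact_mod_cast hS
  have hbound : ∀ N : ℕ, 0 < N → P (E N) ≤ ENNReal.ofReal (b N) := fun N hN => by
    have hN1 : (1 : ℝ) ≤ N := by exact_mod_cast hN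
    have hN0 : (0 : ℝ) < N := by positivity
    have hpow : (1 : ℝ) ≤ S ^ 2 * N ^ 3 := one_le_mul_of_one_le_of_one_le
      (one_le_pow₀ hS1) (one_le_pow₀ hN1)
    refine (measure_union_le _ _).trans ?_
    rw [hb, ENNReal.ofReal_add (by positivity) (by positivity)]
    refine add_le_add ?_ ?_
    · refine (hΦ.measure_not_noVoid_le (m := 36 * S ^ 2 * N ^ 3) hN0 ?_).trans ?_
      · push_cast
        nlinarith
      · refine ENNReal.ofReal_le_ofReal ?_
        have h1 : Real.exp (-(lam * ((N : ℝ) / 2) ^ 2)) ≤ q ^ N := by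
          rw [hq, ← Real.exp_nat_mul, Real.exp_le_exp]
          have : (0 : ℝ) ≤ lam * (N * (N - 1)) :=
            mul_nonneg lam.coe_nonneg (mul_nonneg hN0.le (by linarith))
          linarith
        have h2 : 2 * ((36 * S ^ 2 * N ^ 3 : ℕ) : ℝ) + 1 ≤ 73 * S ^ 2 * N ^ 3 := by
          push_cast
          linarith
        calc _ ≤ (73 * S ^ 2 * N ^ 3 : ℝ) ^ 2 * q ^ N := by gcongr
          _ = _ := by ring
    · refine (hΦ.measure_hasChain_le (by positivity) (by positivity) _ N).trans ?_
      refine ENNReal.ofReal_le_ofReal ?_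
      calc _ ≤ ((4 * N ^ 2 * S ^ 2 : ℕ) : ℝ) * (lam * ((17 * S ^ 2 * N ^ 4) ^ 2 * Real.pi)) *
            (1 / 2) ^ N := by gcongr
        _ = _ := by push_cast; ring
  have hlim : Tendsto b atTop (𝓝 0) := by
    have h1 := (tendsto_pow_const_mul_const_pow_of_lt_one 6 (Real.exp_pos _).le hq1).const_mul C₁
    have h2 := (tendsto_pow_const_mul_const_pow_of_lt_one 10 (r := (1 : ℝ) / 2) (by norm_num)
      (by norm_num)).const_mul C₂
    rw [mul_zero] at h1 h2
    simpa only [add_zero] using h1.add h2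
  -- at scale `0` the bound fails, hence the shift of the index by one
  rw [ae_iff, ← nonpos_iff_eq_zero]
  refine measure_le_of_forall_eventually_mem (D := fun m => E (m + 1))
    (b := fun m => ENNReal.ofReal (b (m + 1))) ?_ (fun m => hbound _ m.succ_pos) ?_
  · intro ω hω
    simp only [Set.mem_ofPred_eq, not_frequently, not_and, not_not] at hω
    filter_upwards [(tendsto_add_atTop_nat 1).eventually hω] with m hm
    by_cases h : (Φ ω).NoVoid (17 * S ^ 2 * (m + 1 : ℕ) ^ 4 + (m + 1 : ℕ)) (m + 1 : ℕ)
    · exact Or.inr (hm m.succ_pos h)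
    · exact Or.inl h
  · simpa using ENNReal.tendsto_ofReal (hlim.comp (tendsto_add_atTop_nat 1))

open Filter in
theorem ae_finite_connectedComponent [IsProbabilityMeasure P]
    (hΦ : IsHomogeneousPoisson P Φ lam) (hlam : 0 < lam) :
    ∀ᵐ ω ∂P, ∀ C : (Φ ω).nnGraph.ConnectedComponent, C.supp.Finite := by
  obtain ⟨S, hS⟩ := exists_nat_gt (2 * lam * Real.pi)
  have hS0 : 0 < S := by
    have : (0 : ℝ) < S := lt_of_le_of_lt (by positivity) hS
    exact_mod_cast this
  have hS1 : (1 : ℝ) ≤ S := by exact_mod_cast hS0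
  have hlS : (lam : ℝ) * (Real.pi * (1 / S) ^ 2) ≤ 1 / 2 := by
    have h1 : (lam : ℝ) * (Real.pi * (1 / S) ^ 2) = lam * Real.pi / S ^ 2 := by ring
    rw [h1, div_le_iff₀ (by positivity)]
    nlinarith
  filter_upwards [hΦ.ae_unique_leader, hΦ.ae_frequently_noVoid_not_hasChain hlam hS0 hlS]
    with ω hT hω C
  induction C using SimpleGraph.ConnectedComponent.ind with
  | h x =>
    obtain ⟨N, hNx, hN, hV, hC⟩ := frequently_atTop.1 hω ⌈‖(x : Plane)‖⌉₊
    have hN1 : (1 : ℝ) ≤ N := by exact_mod_cast hN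
    refine Set.Finite.of_finite_image (f := Subtype.val)
      (((Φ ω).finite_inter _ (isCompact_closedBall 0 (17 * S ^ 2 * N ^ 4 : ℝ))).subset ?_)
      Subtype.val_injective.injOn
    rintro _ ⟨y, hy, rfl⟩
    refine ⟨y.2, mem_closedBall_zero_iff.2 ?_⟩
    refine Config.norm_le_of_reachable hT (R₀ := N) (r := N) (s := 1 / S)
      (J := 4 * N ^ 2 * S ^ 2) (k := N) (by positivity) (by positivity) hN ?_ ?_ hV hC
      ((Nat.le_ceil _).trans (by exact_mod_cast hNx)) (SimpleGraph.ConnectedComponent.exact hy).symm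
    · refine le_of_eq ?_
      push_cast
      field_simp
      ring
    · have h1 : (N : ℝ) ≤ S ^ 2 * N ^ 4 := by
        have h2 : (1 : ℝ) ≤ S ^ 2 * N ^ 3 := one_le_mul_of_one_le_of_one_le
          (one_le_pow₀ hS1) (one_le_pow₀ hN1)
        nlinarith
      push_cast
      linarith

end IsHomogeneousPoisson

/-- Almost surely, every connected component of the nearest neighbour graph of a homogeneous Poisson
point process in the plane is finite, and under its Palm probability the forward and backward sets
of the origin are almost surely finite. -/
theorem mainTheorem1 {Ω : Type*} [MeasurableSpace Ω] (P : Measure Ω) [IsProbabilityMeasure P]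
    (lam : ℝ≥0) (hlam : 0 < lam) (Φ : Ω → Config) (hΦ : IsHomogeneousPoisson P Φ lam) :
    (∀ᵐ ω ∂P, ∀ C : (Φ ω).nnGraph.ConnectedComponent, C.supp.Finite) ∧
    (∀ᵐ η ∂(palm (P.map Φ)), (η.forwardSet 0).Finite ∧ (η.backwardSet 0).Finite) := by
  have hfin := hΦ.ae_finite_connectedComponent hlam
  refine ⟨hfin, ae_palm_of_ae_forall_shift hΦ.measurable
    Config.measurableSet_finite_forwardSet_backwardSet ?_⟩
  filter_upwards [hfin] with ω hω x hx
  exact Config.finite_forwardSet_backwardSet_shift hω hx
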